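/- Let $\mathbb G$ be a Carnot group, that is, a connected, simply connected real Lie group whose Lie algebra of left-invariant vector fields decomposes as $\mathfrak g=\mathfrak g_1\oplus\dots\oplus\mathfrak g_m$ with $[\mathfrak g_1,\mathfrak g_i]=\mathfrak g_{i+1}$ for $1\le i<m$ and $[\mathfrak g_1,\mathfrak g_m]=\{0\}$. Let $dx$ be a Haar measure on $\mathbb G$, and let $X_1,\dots,X_n$ be a basis of $\mathfrak g_1$, regarded as orthonormal. Let $\Omega\subset\mathbb G$ be a domain (a nonempty connected open set), let $(Y,d)$ be a metric space, and let $1\le q\le\infty$. The homogeneous Sobolev space $L^1_q(\Omega)$ consists of all $u\in L_{1,\mathrm{loc}}(\Omega)$ that have generalized derivatives $X_1u,\dots,X_nu\in L_q(\Omega)$, where a locally summable function $u_j$ is the generalized derivative $X_ju$ whenever $\int_\Omega u_j v\,dx=-\int_\Omega u\,X_jv\,dx$ for all $v\in C_0^\infty(\Omega)$. It is equipped with the seminorm $\|u\mid L^1_q(\Omega)\|=\big\|\,|\nabla_h u|\,\mid L_q(\Omega)\big\|$, where $\nabla_h u=(X_1u,\dots,X_nu)$ and $|\cdot|$ is the Euclidean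 norm. The space $\mathrm{Lip}(Y)$ consists of all Lipschitz functions $u:Y\to\mathbb R$ and is equipped with the seminorm $\mathrm{Lip}(u)=\sup_{y_1\ne y_2}|u(y_1)-u(y_2)|/d(y_1,y_2)$ (equal to $0$ if $Y$ is a single point). If a mapping $\varphi:\Omega\to Y$ satisfies $u\circ\varphi\in L^1_q(\Omega)$ for every $u\in\mathrm{Lip}(Y)$, then the composition operator $$\varphi^*:\mathrm{Lip}(Y)\to L^1_q(\Omega),\qquad \varphi^*u=u\circ\varphi,$$ is bounded: there is a constant $C<\infty$ such that $\|u\circ\varphi\mid L^1_q(\Omega)\|\le C\,\mathrm{Lip}(u)$ for all $u\in\mathrm{Lip}(Y)$. -/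

import Mathlib

open MeasureTheory Set Function
open scoped Manifold ContDiff ENNReal NNReal

noncomputable section

/-- The commutator `[V, W]` of two subspaces of the Lie algebra of a Lie group: the linear span of
all the brackets `⁅v, w⁆` with `v ∈ V` and `w ∈ W`. -/
def bracketSpan {E G : Type*} [NormedAddCommGroup E] [NormedSpace ℝ E]
    [TopologicalSpace G] [ChartedSpace E G] [Group G]
    (V W : Submodule ℝ (GroupLieAlgebra 𝓘(ℝ, E) G)) :
    Submodule ℝ (GroupLieAlgebra 𝓘(ℝ, E) G) :=
  Submodule.span ℝ {z | ∃ v ∈ V, ∃ w ∈ W, ⁅v, w⁆ = z}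

/-- A stratification `𝔤 = 𝔤₁ ⊕ ⋯ ⊕ 𝔤ₘ` of the Lie algebra of `G`, with `[𝔤₁, 𝔤ᵢ] = 𝔤ᵢ₊₁` for
`1 ≤ i < m` and `[𝔤₁, 𝔤ₘ] = 0`. A Carnot group is a connected and simply connected
finite-dimensional real Lie group with such a stratification.
Only `layer 1, …, layer step` carry information. -/
structure Stratification (E G : Type*) [NormedAddCommGroup E] [NormedSpace ℝ E]
    [TopologicalSpace G] [ChartedSpace E G] [Group G] where
  /-- The number `m` of layers. -/
  step : ℕ
  one_le_step : 1 ≤ step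
  /-- The layers `𝔤ᵢ`. -/
  layer : ℕ → Submodule ℝ (GroupLieAlgebra 𝓘(ℝ, E) G)
  isInternal : DirectSum.IsInternal fun i : Fin step => layer (i + 1)
  bracket_layer : ∀ i, 1 ≤ i → i < step → bracketSpan (layer 1) (layer i) = layer (i + 1)
  bracket_last : bracketSpan (layer 1) (layer step) = ⊥

/-- The horizontal space `𝔤₁`. -/
def Stratification.horizontal {E G : Type*} [NormedAddCommGroup E] [NormedSpace ℝ E]
    [TopologicalSpace G] [ChartedSpace E G] [Group G] (S : Stratification E G) :
    Submodule ℝ (GroupLieAlgebra 𝓘(ℝ, E) G) :=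
  S.layer 1

section Sobolev

variable {E G : Type*} [NormedAddCommGroup E] [NormedSpace ℝ E]
  [TopologicalSpace G] [ChartedSpace E G] [Group G]

/-- The derivative at `x` of a function `v : G → ℝ` along the left-invariant vector field which is
`ξ` at the neutral element. -/
def leftInvDeriv (ξ : GroupLieAlgebra 𝓘(ℝ, E) G) (v : G → ℝ) (x : G) : ℝ :=
  mfderiv 𝓘(ℝ, E) 𝓘(ℝ, ℝ) v x (mulInvariantVectorField ξ x)

variable [MeasurableSpace G]

/-- `w` is a generalized derivative of `u` along `ξ` in `Ω`: it is locally summable in `Ω` and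
`∫_Ω w v = - ∫_Ω u (ξ v)` for all test functions `v ∈ C₀^∞(Ω)`. -/
def IsGeneralizedDeriv (μ : Measure G) (Ω : Set G) (ξ : GroupLieAlgebra 𝓘(ℝ, E) G)
    (u w : G → ℝ) : Prop :=
  LocallyIntegrableOn w Ω μ ∧
    ∀ v : G → ℝ, ContMDiff 𝓘(ℝ, E) 𝓘(ℝ, ℝ) ∞ v → HasCompactSupport v → tsupport v ⊆ Ω →
      ∫ x in Ω, w x * v x ∂μ = -∫ x in Ω, u x * leftInvDeriv ξ v x ∂μ

/-- `g` is a horizontal gradient of `u` in `Ω`, in coordinates with respect to the basis `X` of the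
horizontal space `V`; `X` is regarded as orthonormal, so that `‖g x‖` is the Euclidean norm. -/
def IsHorizontalGradient (μ : Measure G) (Ω : Set G) {n : ℕ}
    {V : Submodule ℝ (GroupLieAlgebra 𝓘(ℝ, E) G)} (X : Module.Basis (Fin n) ℝ V)
    (u : G → ℝ) (g : G → EuclideanSpace ℝ (Fin n)) : Prop :=
  ∀ j, IsGeneralizedDeriv μ Ω (X j : GroupLieAlgebra 𝓘(ℝ, E) G) u (fun x => g x j)

/-- Horizontal gradients are unique up to null sets. -/
theorem IsHorizontalGradient.ae_eq [FiniteDimensional ℝ E] [LieGroup 𝓘(ℝ, E) ∞ G] [BorelSpace G]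
    [T2Space G] [SigmaCompactSpace G] {μ : Measure G} {Ω : Set G} (hΩ : IsOpen Ω) {n : ℕ}
    {V : Submodule ℝ (GroupLieAlgebra 𝓘(ℝ, E) G)} {X : Module.Basis (Fin n) ℝ V}
    {u : G → ℝ} {g h : G → EuclideanSpace ℝ (Fin n)}
    (hg : IsHorizontalGradient μ Ω X u g) (hh : IsHorizontalGradient μ Ω X u h) :
    g =ᵐ[μ.restrict Ω] h := by
  have key : ∀ j, ∀ᵐ x ∂μ, x ∈ Ω → g x j - h x j = 0 := by
    intro j
    have hloc : LocallyIntegrableOn (fun x => g x j - h x j) Ω μ := (hg j).1.sub (hh j).1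
    refine hΩ.ae_eq_zero_of_integral_contMDiff_smul_eq_zero 𝓘(ℝ, E) hloc ?_
    intro v hv hc hs
    have hint : ∀ w : G → ℝ, LocallyIntegrableOn w Ω μ → IntegrableOn (fun x => w x * v x) Ω μ := by
      intro w hw
      have h1 : IntegrableOn (fun x => w x * v x) (tsupport v) μ :=
        (hw.integrableOn_compact_subset hs hc).mul_continuousOn hv.continuous.continuousOn hc
      refine IntegrableOn.mono_set ((integrableOn_iff_integrable_of_support_subset ?_).1 h1
        |>.integrableOn) (subset_univ Ω)
      intro x hx
      exact subset_tsupport v (by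
        intro h0
        exact hx (by simp [h0]))
    have e1 := (hg j).2 v hv hc hs
    have e2 := (hh j).2 v hv hc hs
    have e3 : ∫ x in Ω, (g x j - h x j) * v x ∂μ = 0 := by
      simp_rw [sub_mul]
      rw [integral_sub (hint _ (hg j).1) (hint _ (hh j).1), e1, e2, sub_self]
    rw [← e3, setIntegral_eq_integral_of_forall_compl_eq_zero]
    · exact integral_congr_ae (Filter.Eventually.of_forall fun x => by simp [mul_comm])
    · intro x hx
      have : v x = 0 := image_eq_zero_of_notMem_tsupport fun h => hx (hs h)
      simp [this]
  refine (ae_restrict_iff' hΩ.measurableSet).2 ?_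
  filter_upwards [MeasureTheory.ae_all_iff.2 key] with x hx hxΩ
  ext j
  exact sub_eq_zero.1 (hx j hxΩ)

open scoped Classical in
/-- The horizontal gradient `∇ₕ u` of `u` in `Ω` (unique up to null sets when it exists, and zero
by convention when it does not). -/
def horizontalGradient (μ : Measure G) (Ω : Set G) {n : ℕ}
    {V : Submodule ℝ (GroupLieAlgebra 𝓘(ℝ, E) G)} (X : Module.Basis (Fin n) ℝ V)
    (u : G → ℝ) : G → EuclideanSpace ℝ (Fin n) :=
  if h : ∃ g, IsHorizontalGradient μ Ω X u g then h.choose else 0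

/-- Membership in the homogeneous Sobolev space `L¹_q(Ω)`: `u` is locally summable in `Ω` and has
generalized derivatives along the basis of the horizontal space which lie in `L_q(Ω)`. -/
def MemHomSobolev (q : ℝ≥0∞) (μ : Measure G) (Ω : Set G) {n : ℕ}
    {V : Submodule ℝ (GroupLieAlgebra 𝓘(ℝ, E) G)} (X : Module.Basis (Fin n) ℝ V)
    (u : G → ℝ) : Prop :=
  LocallyIntegrableOn u Ω μ ∧
    ∃ g, IsHorizontalGradient μ Ω X u g ∧ MemLp g q (μ.restrict Ω)

/-- The seminorm `‖u | L¹_q(Ω)‖ = ‖ |∇ₕ u| | L_q(Ω)‖`, meaningful for `u ∈ L¹_q(Ω)`. -/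
def homSobolevSeminorm (q : ℝ≥0∞) (μ : Measure G) (Ω : Set G) {n : ℕ}
    {V : Submodule ℝ (GroupLieAlgebra 𝓘(ℝ, E) G)} (X : Module.Basis (Fin n) ℝ V)
    (u : G → ℝ) : ℝ≥0∞ :=
  eLpNorm (horizontalGradient μ Ω X u) q (μ.restrict Ω)

end Sobolev

/-- Membership in `Lip(Y)`. -/
def MemLip {Y : Type*} [MetricSpace Y] (u : Y → ℝ) : Prop :=
  ∃ K : ℝ≥0, LipschitzWith K u

/-- The seminorm `Lip(u) = sup_{y₁ ≠ y₂} |u(y₁) - u(y₂)| / d(y₁, y₂)`, as an extended nonnegative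
number; it is finite for `u ∈ Lip(Y)`. -/
def lipSeminorm {Y : Type*} [MetricSpace Y] (u : Y → ℝ) : ℝ≥0∞ :=
  ⨆ (y₁ : Y) (y₂ : Y) (_ : y₁ ≠ y₂), ENNReal.ofReal (|u y₁ - u y₂| / dist y₁ y₂)

/-- `φ` induces a bounded composition operator `φ* : Lip(Y) → L¹_q(Ω)`, `φ* u = u ∘ φ`.
Only the values of `φ` on `Ω` matter. -/
def InducesBoundedCompositionOperator {E G Y : Type*} [NormedAddCommGroup E] [NormedSpace ℝ E]
    [TopologicalSpace G] [ChartedSpace E G] [Group G] [MeasurableSpace G] [MetricSpace Y]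
    (q : ℝ≥0∞) (μ : Measure G) (Ω : Set G) {n : ℕ}
    {V : Submodule ℝ (GroupLieAlgebra 𝓘(ℝ, E) G)} (X : Module.Basis (Fin n) ℝ V)
    (φ : G → Y) : Prop :=
  (∀ u : Y → ℝ, MemLip u → MemHomSobolev q μ Ω X (u ∘ φ)) ∧
    ∃ C : ℝ≥0, ∀ u : Y → ℝ, MemLip u →
      homSobolevSeminorm q μ Ω X (u ∘ φ) ≤ C * lipSeminorm u

end

set_option linter.unusedSectionVars false

open scoped Pointwise

/-! ### Calculus of left-invariant derivatives on a Lie group. -/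

section LieGroupCalculus

variable {E G : Type*} [NormedAddCommGroup E] [NormedSpace ℝ E]
  [TopologicalSpace G] [ChartedSpace E G] [Group G] [LieGroup 𝓘(ℝ, E) ∞ G]

/-! The theorem is an instance of the closed graph theorem. Modulo constants, Lip(Y) is a Banach
space, realized as the closed subspace `lipQuotients Y` of bounded functions on `Y × Y`. The linear
map to be bounded, `gradientComp`, sends a family of difference quotients to the horizontal gradient
in `L_q` of `u ∘ φ`, where `u` is the primitive vanishing at a base point `y₀`.

The graph is closed for the following reason. If the quotients converge, the primitives converge
with error at most a null sequence times `dist · y₀`. That distance is itself Lipschitz, so by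
hypothesis its composite with `φ` is locally summable, and the integrals of the composites against
derivatives of test functions converge. Convergence of the gradients in `L_q` handles the other side
of the defining identity, and uniqueness of the gradient identifies the limit
(`continuous_gradientComp`).

Passing to the quotient by constants requires constants to have gradient zero, that is, `∫ ζ v = 0`
for horizontal `ζ` and test functions `v`. Left-invariant fields generate right translations,
whereas `μ` is only assumed to be left-invariant. Hence the longer half of the proof: the divergence
of `ζ` is the trace of `ad ζ` (`integral_leftInvDeriv_eq_trace_mul`), and `ad ζ` is nilpotent
because it raises the layer (`isNilpotent_adDeriv`). -/

lemma mdifferentiable_left_mul (x : G) :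
    MDifferentiable 𝓘(ℝ, E) 𝓘(ℝ, E) (fun y : G => x * y) :=
  (contMDiff_mul_left (I := 𝓘(ℝ, E)) (n := ∞) (a := x)).mdifferentiable (by simp)

lemma leftInvDeriv_eq (ξ : GroupLieAlgebra 𝓘(ℝ, E) G) {v : G → ℝ}
    (hv : MDifferentiable 𝓘(ℝ, E) 𝓘(ℝ, ℝ) v) (x : G) :
    leftInvDeriv ξ v x = mfderiv 𝓘(ℝ, E) 𝓘(ℝ, ℝ) (fun y => v (x * y)) 1 ξ := by
  have h := mfderiv_comp (I := 𝓘(ℝ, E)) (I' := 𝓘(ℝ, E)) (I'' := 𝓘(ℝ, ℝ)) (1 : G)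
    (g := v) (f := fun y => x * y) (hv _) (mdifferentiable_left_mul x _)
  have h2 : (fun y => v (x * y)) = v ∘ (fun y => x * y) := rfl
  rw [h2, h]
  simp only [leftInvDeriv, mulInvariantVectorField]
  change _ = mfderiv 𝓘(ℝ, E) 𝓘(ℝ, ℝ) v (x * 1) (mfderiv 𝓘(ℝ, E) 𝓘(ℝ, E) (fun y => x * y) 1 ξ)
  rw [mul_one]

/-- Smooth dependence of a derivative on parameters is a statement in tangent coordinates. With the
base point `p` fixed and all values `f x p` in the same preferred chart, the coordinate changes are
identities, so the derivative is smooth as a plain map into `E →L[ℝ] F`. -/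
lemma ContMDiff.mfderiv_at_const {F E' H N M M' : Type*} [NormedAddCommGroup F] [NormedSpace ℝ F]
    [TopologicalSpace H] [TopologicalSpace N] [NormedAddCommGroup E'] [NormedSpace ℝ E']
    {J : ModelWithCorners ℝ E' H} [ChartedSpace H N] [IsManifold J 1 N]
    [TopologicalSpace M] [ChartedSpace E M] [IsManifold 𝓘(ℝ, E) 1 M]
    [TopologicalSpace M'] [ChartedSpace F M'] [IsManifold 𝓘(ℝ, F) 1 M']
    {f : N → M → M'} {p : M} {m : ℕ∞}
    (hf : ContMDiff (J.prod 𝓘(ℝ, E)) 𝓘(ℝ, F) ∞ (uncurry f)) 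
    (hp : ∀ x x', chartAt F (f x p) = chartAt F (f x' p))
    {D : N → E →L[ℝ] F} (hD : ∀ x, D x = (mfderiv 𝓘(ℝ, E) 𝓘(ℝ, F) (f x) p :)) :
    ContMDiff J 𝓘(ℝ, E →L[ℝ] F) m D := by
  intro x₀
  have h := ContMDiffAt.mfderiv (m := m) (n := ∞) (J := J) (I := 𝓘(ℝ, E)) (I' := 𝓘(ℝ, F))
    (x₀ := x₀) f (fun _ => p) (hf _) contMDiffAt_const (by exact_mod_cast le_top)
  convert! h using 1
  ext x w
  have h0 := inTangentCoordinates_eq (I := 𝓘(ℝ, E)) (I' := 𝓘(ℝ, F)) (fun _ : N => p)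
    (fun x => f x p) D (x₀ := x₀) (x := x) (mem_chart_source _ _)
    (by rw [← hp x x₀]; exact mem_chart_source _ _)
  have hDf : D = fun x => (mfderiv 𝓘(ℝ, E) 𝓘(ℝ, F) (f x) p :) := funext hD
  rw [hDf] at h0
  refine Eq.trans ?_ (DFunLike.congr_fun h0 w).symm
  have h1 := (tangentBundleCore 𝓘(ℝ, E) M).coordChange_self (achart E p) p
    (mem_chart_source _ _) w
  have h2 := (tangentBundleCore 𝓘(ℝ, F) M').coordChange_self (achart F (f x p)) (f x p)
    (mem_chart_source _ _) (D x w)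
  have h3 : achart F (f x₀ p) = achart F (f x p) := Subtype.ext (hp _ _)
  change _ = (tangentBundleCore 𝓘(ℝ, F) M').coordChange (achart F (f x p)) (achart F (f x₀ p))
    (f x p) (mfderiv 𝓘(ℝ, E) 𝓘(ℝ, F) (f x) p
      ((tangentBundleCore 𝓘(ℝ, E) M).coordChange (achart E p) (achart E p) p w))
  rw [h1, h3]
  rw [hD x] at h2 ⊢
  exact h2.symm

lemma contMDiff_leftInvDeriv (ξ : GroupLieAlgebra 𝓘(ℝ, E) G) {v : G → ℝ}
    (hv : ContMDiff 𝓘(ℝ, E) 𝓘(ℝ, ℝ) ∞ v) :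
    ContMDiff 𝓘(ℝ, E) 𝓘(ℝ, ℝ) ∞ (leftInvDeriv ξ v) := by
  have : IsManifold 𝓘(ℝ, E) 1 G := IsManifold.of_le (n := ∞) (by simp)
  have h : ContMDiff (𝓘(ℝ, E).prod 𝓘(ℝ, E)) 𝓘(ℝ, ℝ) ∞ (uncurry fun x y : G => v (x * y)) :=
    hv.comp (contMDiff_mul 𝓘(ℝ, E) ∞)
  have h1 : ∀ x : G, MDifferentiable 𝓘(ℝ, E) 𝓘(ℝ, ℝ) fun y => v (x * y) := fun x =>
    (hv.mdifferentiable (by simp)).comp (mdifferentiable_left_mul x)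
  let D : G → E →L[ℝ] ℝ := fun x => (mfderiv 𝓘(ℝ, E) 𝓘(ℝ, ℝ) (fun y => v (x * y)) 1 :)
  have hD : ContMDiff 𝓘(ℝ, E) 𝓘(ℝ, E →L[ℝ] ℝ) ∞ D :=
    ContMDiff.mfderiv_at_const h (fun _ _ => rfl) fun _ => rfl
  have h3 : leftInvDeriv ξ v = fun x => D x ξ := by
    ext x
    exact leftInvDeriv_eq ξ (hv.mdifferentiable (by simp)) x
  rw [h3]
  exact hD.clm_apply (contMDiff_const (c := (show E from ξ)))

lemma leftInvDeriv_add_left (ξ η : GroupLieAlgebra 𝓘(ℝ, E) G) (v : G → ℝ) (x : G) :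
    leftInvDeriv (ξ + η) v x = leftInvDeriv ξ v x + leftInvDeriv η v x := by
  simp only [leftInvDeriv, mulInvariantVectorField_add, Pi.add_apply]
  exact map_add _ _ _

lemma leftInvDeriv_smul_left (c : ℝ) (ξ : GroupLieAlgebra 𝓘(ℝ, E) G) (v : G → ℝ) (x : G) :
    leftInvDeriv (c • ξ) v x = c * leftInvDeriv ξ v x := by
  simp only [leftInvDeriv, mulInvariantVectorField_smul, Pi.smul_apply]
  exact map_smul _ _ _

lemma leftInvDeriv_mul (ξ : GroupLieAlgebra 𝓘(ℝ, E) G) {v w : G → ℝ}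
    (hv : MDifferentiable 𝓘(ℝ, E) 𝓘(ℝ, ℝ) v) (hw : MDifferentiable 𝓘(ℝ, E) 𝓘(ℝ, ℝ) w) (x : G) :
    leftInvDeriv ξ (fun y => v y * w y) x
      = v x * leftInvDeriv ξ w x + w x * leftInvDeriv ξ v x := by
  have h := ((hv x).hasMFDerivAt.mul (hw x).hasMFDerivAt).mfderiv
  have h2 : (fun y => v y * w y) = v * w := rfl
  simp only [leftInvDeriv]
  rw [h2, h]
  rfl

lemma leftInvDeriv_eq_zero_of_notMem_tsupport (ξ : GroupLieAlgebra 𝓘(ℝ, E) G) {v : G → ℝ} {x : G}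
    (hx : x ∉ tsupport v) : leftInvDeriv ξ v x = 0 := by
  have h : v =ᶠ[nhds x] fun _ => 0 := notMem_tsupport_iff_eventuallyEq.1 hx
  simp only [leftInvDeriv]
  rw [h.mfderiv_eq, mfderiv_const]
  rfl

lemma HasCompactSupport.leftInvDeriv [T2Space G] (ξ : GroupLieAlgebra 𝓘(ℝ, E) G) {v : G → ℝ}
    (hv : HasCompactSupport v) : HasCompactSupport (leftInvDeriv ξ v) :=
  HasCompactSupport.intro hv fun _ hx => leftInvDeriv_eq_zero_of_notMem_tsupport ξ hx

lemma exists_integralCurve [FiniteDimensional ℝ E] (ξ : GroupLieAlgebra 𝓘(ℝ, E) G) :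
    ∃ γ : ℝ → G, γ 0 = 1 ∧ IsMIntegralCurveAt (I := 𝓘(ℝ, E)) γ (mulInvariantVectorField ξ) 0 := by
  have : IsManifold 𝓘(ℝ, E) 1 G := IsManifold.of_le (n := ∞) (by simp)
  have : LieGroup 𝓘(ℝ, E) (minSmoothness ℝ 3) G := LieGroup.of_le (n := ∞) (by
    simp only [minSmoothness_of_isRCLikeNormedField]
    exact WithTop.coe_le_coe.2 (le_top : (3 : ℕ∞) ≤ ⊤))
  have : CompleteSpace E := FiniteDimensional.complete ℝ E
  have h2 : (2 : WithTop ℕ∞) ≤ 3 := by norm_num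
  exact exists_isMIntegralCurveAt_of_contMDiffAt_boundaryless 0
    ((contMDiff_mulInvariantVectorField ξ 1).of_le (by simp))

lemma mfderiv_mul_left_mulInvariantVectorField (ξ : GroupLieAlgebra 𝓘(ℝ, E) G) (x y : G) :
    mfderiv 𝓘(ℝ, E) 𝓘(ℝ, E) (fun z => x * z) y (mulInvariantVectorField ξ y)
      = mulInvariantVectorField ξ (x * y) := by
  have h := mfderiv_comp (I := 𝓘(ℝ, E)) (I' := 𝓘(ℝ, E)) (I'' := 𝓘(ℝ, E)) (1 : G)
    (g := fun z => x * z) (f := fun z => y * z) (mdifferentiable_left_mul x _)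
    (mdifferentiable_left_mul y _)
  have h2 : (fun z => x * z) ∘ (fun z => y * z) = fun z => x * y * z := by
    ext z; simp [mul_assoc]
  rw [h2] at h
  simp only [mulInvariantVectorField]
  rw [h]
  change _ = mfderiv 𝓘(ℝ, E) 𝓘(ℝ, E) (fun z => x * z) (y * 1)
    (mfderiv 𝓘(ℝ, E) 𝓘(ℝ, E) (fun z => y * z) 1 ξ)
  rw [mul_one]

lemma hasDerivAt_comp_integralCurve {ξ : GroupLieAlgebra 𝓘(ℝ, E) G} {v : G → ℝ}
    (hv : MDifferentiable 𝓘(ℝ, E) 𝓘(ℝ, ℝ) v) {γ : ℝ → G} {t : ℝ}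
    (hγ : HasMFDerivAt 𝓘(ℝ, ℝ) 𝓘(ℝ, E) γ t
      (ContinuousLinearMap.smulRight (1 : ℝ →L[ℝ] ℝ) (mulInvariantVectorField ξ (γ t)))) (x : G) :
    HasDerivAt (fun s => v (x * γ s)) (leftInvDeriv ξ v (x * γ t)) t := by
  have h1 := (mdifferentiable_left_mul (E := E) x (γ t)).hasMFDerivAt.comp t hγ
  have h2 := (hv (x * γ t)).hasMFDerivAt.comp t h1
  have h3 : HasFDerivAt (fun s => v (x * γ s)) (_ : ℝ →L[ℝ] ℝ) t := h2.hasFDerivAt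
  refine h3.hasDerivAt.congr_deriv ?_
  symm
  simp only [leftInvDeriv]
  rw [← mfderiv_mul_left_mulInvariantVectorField]
  change _ = mfderiv 𝓘(ℝ, E) 𝓘(ℝ, ℝ) v (x * γ t)
    (mfderiv 𝓘(ℝ, E) 𝓘(ℝ, E) (fun z => x * z) (γ t) ((1 : ℝ) • (mulInvariantVectorField ξ (γ t))))
  rw [one_smul]

end LieGroupCalculus

/-! ### Left-invariant fields have constant divergence for a Haar measure. -/

/-- Right translation carries `μ` to another left-invariant measure, and these are unique up to a
factor. What matters later is that `κ` does not depend on `v`. -/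
lemma integral_comp_mul_right_eq_mul {G : Type*} [TopologicalSpace G] [Group G]
    [IsTopologicalGroup G] [LocallyCompactSpace G] [MeasurableSpace G] [BorelSpace G]
    (μ : Measure G) [μ.IsHaarMeasure] (g : G) :
    ∃ κ : ℝ, ∀ v : G → ℝ, Continuous v → HasCompactSupport v →
      ∫ x, v (x * g) ∂μ = κ * ∫ x, v x ∂μ := by
  refine ⟨Measure.haarScalarFactor (μ.map (· * g)) μ, fun v hv hc => ?_⟩
  have h := Measure.integral_isMulLeftInvariant_eq_smul_of_hasCompactSupport
    (μ.map (· * g)) μ hv hc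
  have h' : ∫ x, v x ∂μ.map (· * g) = ∫ x, v (x * g) ∂μ :=
    (Homeomorph.mulRight g).measurableEmbedding.integral_map v
  rw [h', integral_smul_nnreal_measure] at h
  exact h

section LieGroupIntegral

variable {E G : Type*} [NormedAddCommGroup E] [NormedSpace ℝ E] [FiniteDimensional ℝ E]
  [TopologicalSpace G] [T2Space G] [SecondCountableTopology G]
  [ChartedSpace E G] [Group G] [LieGroup 𝓘(ℝ, E) ∞ G] [MeasurableSpace G] [BorelSpace G]

/-- Differentiation under the integral along the integral curves `x * γ t`, the left translates of a
single curve through `1`. The curve is chosen before `v`, so that two test functions can be compared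
along it. -/
lemma integral_leftInvDeriv_eq_of_hasDerivAt (ν : Measure G) [IsFiniteMeasureOnCompacts ν]
    (ξ : GroupLieAlgebra 𝓘(ℝ, E) G) :
    ∃ γ : ℝ → G, γ 0 = 1 ∧ ∀ v : G → ℝ, ContMDiff 𝓘(ℝ, E) 𝓘(ℝ, ℝ) ∞ v → HasCompactSupport v →
      HasDerivAt (fun t => ∫ x, v (x * γ t) ∂ν) (∫ x, leftInvDeriv ξ v x ∂ν) 0 := by
  have : IsTopologicalGroup G := topologicalGroup_of_lieGroup 𝓘(ℝ, E) ∞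
  have : LocallyCompactSpace G := Manifold.locallyCompact_of_finiteDimensional 𝓘(ℝ, E)
  obtain ⟨γ, hγ0, hγ⟩ := exists_integralCurve ξ
  refine ⟨γ, hγ0, fun v hv hc => ?_⟩
  have hDc : Continuous (leftInvDeriv ξ v) := (contMDiff_leftInvDeriv ξ hv).continuous
  obtain ⟨C, hC⟩ := hDc.bounded_above_of_compact_support (hc.leftInvDeriv ξ)
  obtain ⟨N, hN, hN1⟩ := exists_compact_mem_nhds (1 : G)
  have hγc : ContinuousAt γ 0 := hγ.self_of_nhds.continuousAt
  have hγN : ∀ᶠ t in nhds (0 : ℝ), γ t ∈ N := hγc (by rw [hγ0]; exact hN1)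
  -- While `γ t` stays in `N`, all the translates `x ↦ leftInvDeriv ξ v (x * γ t)` vanish outside
  -- this one compact set, which yields an integrable majorant.
  set K : Set G := tsupport v * N⁻¹ with hK
  have hKc : IsCompact K := hc.isCompact.mul hN.inv
  have hvc : Continuous v := hv.continuous
  have hcomp (t : ℝ) : HasCompactSupport fun x => v (x * γ t) :=
    hc.comp_homeomorph (Homeomorph.mulRight (γ t))
  have key := hasDerivAt_integral_of_dominated_loc_of_deriv_le (μ := ν) (𝕜 := ℝ) (x₀ := 0)
    (F := fun t x => v (x * γ t)) (F' := fun t x => leftInvDeriv ξ v (x * γ t))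
    (bound := K.indicator fun _ => C) (s := {t | γ t ∈ N ∧ HasMFDerivAt 𝓘(ℝ, ℝ) 𝓘(ℝ, E) γ t
      (ContinuousLinearMap.smulRight (1 : ℝ →L[ℝ] ℝ) (mulInvariantVectorField ξ (γ t)))})
    (hγN.and hγ) (Filter.Eventually.of_forall fun t => by
      exact (hvc.comp (continuous_mul_const _)).aestronglyMeasurable)
    ((hvc.comp (continuous_mul_const _)).integrable_of_hasCompactSupport (hcomp 0))
    (hDc.comp (continuous_mul_const _)).aestronglyMeasurable
    (Filter.Eventually.of_forall fun x t ht => ?_)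
    ((integrable_indicator_iff hKc.measurableSet).2
      (integrableOn_const hKc.measure_lt_top.ne))
    (Filter.Eventually.of_forall fun x t ht =>
      hasDerivAt_comp_integralCurve (hv.mdifferentiable (by simp)) ht.2 x)
  · simpa [hγ0] using key.2
  · by_cases hx : x ∈ K
    · simpa [hx] using hC _
    · rw [leftInvDeriv_eq_zero_of_notMem_tsupport]
      · simp [hx]
      · intro h
        exact hx ⟨_, h, (γ t)⁻¹, by simpa using ht.1, by simp⟩

lemma integral_leftInvDeriv_of_isMulRightInvariant (ν : Measure G) [IsFiniteMeasureOnCompacts ν]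
    [ν.IsMulRightInvariant] (ξ : GroupLieAlgebra 𝓘(ℝ, E) G) {v : G → ℝ}
    (hv : ContMDiff 𝓘(ℝ, E) 𝓘(ℝ, ℝ) ∞ v) (hc : HasCompactSupport v) :
    ∫ x, leftInvDeriv ξ v x ∂ν = 0 := by
  have : IsTopologicalGroup G := topologicalGroup_of_lieGroup 𝓘(ℝ, E) ∞
  obtain ⟨γ, -, hγ⟩ := integral_leftInvDeriv_eq_of_hasDerivAt ν ξ
  have h := hγ v hv hc
  simp_rw [integral_mul_right_eq_self v] at h
  exact h.unique (hasDerivAt_const _ _)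

/-- A left-invariant vector field has constant divergence with respect to a Haar measure. -/
lemma exists_integral_leftInvDeriv_eq_mul (μ : Measure G) [μ.IsHaarMeasure] :
    ∃ c : GroupLieAlgebra 𝓘(ℝ, E) G →ₗ[ℝ] ℝ, ∀ ξ, ∀ v : G → ℝ, ContMDiff 𝓘(ℝ, E) 𝓘(ℝ, ℝ) ∞ v →
      HasCompactSupport v → ∫ x, leftInvDeriv ξ v x ∂μ = c ξ * ∫ x, v x ∂μ := by
  have : IsTopologicalGroup G := topologicalGroup_of_lieGroup 𝓘(ℝ, E) ∞
  have : LocallyCompactSpace G := Manifold.locallyCompact_of_finiteDimensional 𝓘(ℝ, E)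
  obtain ⟨v₀, hv₀, hc₀, h₀⟩ : ∃ v₀ : G → ℝ, ContMDiff 𝓘(ℝ, E) 𝓘(ℝ, ℝ) ∞ v₀ ∧
      HasCompactSupport v₀ ∧ ∫ x, v₀ x ∂μ ≠ 0 := by
    have f : SmoothBumpFunction 𝓘(ℝ, E) (1 : G) :=
      Classical.choice inferInstance
    refine ⟨f, f.contMDiff, f.hasCompactSupport, ?_⟩
    refine (f.continuous.integral_pos_of_hasCompactSupport_nonneg_nonzero f.hasCompactSupport
      (fun _ => f.nonneg) (x := 1) ?_).ne'
    rw [f.eq_one]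
    exact one_ne_zero
  have hint (ξ : GroupLieAlgebra 𝓘(ℝ, E) G) : Integrable (leftInvDeriv ξ v₀) μ :=
    (contMDiff_leftInvDeriv ξ hv₀).continuous.integrable_of_hasCompactSupport (hc₀.leftInvDeriv ξ)
  refine ⟨⟨⟨fun ξ => (∫ x, leftInvDeriv ξ v₀ x ∂μ) / ∫ x, v₀ x ∂μ, fun ξ η => ?_⟩, fun r ξ => ?_⟩,
    fun ξ v hv hc => ?_⟩
  · simp_rw [leftInvDeriv_add_left]
    rw [integral_add (hint ξ) (hint η), add_div]
  · simp_rw [leftInvDeriv_smul_left]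
    rw [integral_const_mul]
    simp [mul_div_assoc]
  · obtain ⟨γ, -, hγ⟩ := integral_leftInvDeriv_eq_of_hasDerivAt μ ξ
    -- Both `t`-dependent integrals are `κ (γ t)` times a constant. Since `∫ v₀ ≠ 0`, the function
    -- for `v` is a constant multiple of the one for `v₀`, and so is its derivative;
    -- differentiability of `κ ∘ γ` need not be known beforehand.
    choose κ hκ using integral_comp_mul_right_eq_mul μ
    have h1 := hγ v hv hc
    have h2 := hγ v₀ hv₀ hc₀
    simp_rw [fun t => hκ (γ t) v hv.continuous hc] at h1
    simp_rw [fun t => hκ (γ t) v₀ hv₀.continuous hc₀] at h2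
    have h3 := h2.mul_const ((∫ x, v x ∂μ) / ∫ x, v₀ x ∂μ)
    have h4 := h1.unique (h3.congr_of_eventuallyEq (Filter.Eventually.of_forall fun t => by
      field_simp))
    rw [h4]
    simp only [LinearMap.coe_mk, AddHom.coe_mk]
    ring

end LieGroupIntegral

/-! ### Left- and right-invariant fields, and the derivative of the adjoint action. -/

section InvariantFields

variable {E : Type*} [NormedAddCommGroup E] [NormedSpace ℝ E]

/-- Here `m` plays the role of the group law in a chart, `∂₂m(p, p₀) w` is the left-invariant field
of `w`, and `h` expresses the right-invariant field of `ζ` as a left-invariant one with variable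
coefficient `b`. Differentiating `h` at `p₀` along `η` gives `b' η` as a difference of two mixed
second derivatives of `m`, which by symmetry of the second derivative is the bracket. -/
lemma lieBracket_fderiv_eq_of_eventually_eq {m : E × E → E} {p₀ ζ η : E} {b : E → E}
    {b' : E →L[ℝ] E} (hm : ContDiffAt ℝ 2 m (p₀, p₀))
    (hm0 : ∀ w, fderiv ℝ m (p₀, p₀) (0, w) = w) (hb : HasFDerivAt b b' p₀) (hb0 : b p₀ = ζ)
    (h : ∀ᶠ q in nhds p₀, fderiv ℝ m (p₀, q) (ζ, 0) = fderiv ℝ m (q, p₀) (0, b q)) :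
    VectorField.lieBracket ℝ (fun p => fderiv ℝ m (p, p₀) (0, ζ))
      (fun p => fderiv ℝ m (p, p₀) (0, η)) p₀ = b' η := by
  have hD : HasFDerivAt (fderiv ℝ m) (fderiv ℝ (fderiv ℝ m) (p₀, p₀)) (p₀, p₀) :=
    ((hm.fderiv_right (m := 1) (by norm_num)).differentiableAt (by simp)).hasFDerivAt
  have hsymm := hm.isSymmSndFDerivAt (by simp)
  have hl : HasFDerivAt (fun p => fderiv ℝ m (p, p₀))
      ((fderiv ℝ (fderiv ℝ m) (p₀, p₀)).comp (ContinuousLinearMap.inl ℝ E E)) p₀ :=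
    HasFDerivAt.comp p₀ (f := fun p => (p, p₀)) hD (hasFDerivAt_prodMk_left p₀ p₀)
  have hr : HasFDerivAt (fun q => fderiv ℝ m (p₀, q))
      ((fderiv ℝ (fderiv ℝ m) (p₀, p₀)).comp (ContinuousLinearMap.inr ℝ E E)) p₀ :=
    HasFDerivAt.comp p₀ (f := fun q => (p₀, q)) hD (hasFDerivAt_prodMk_right p₀ p₀)
  have hX (w : E) : HasFDerivAt (fun p => fderiv ℝ m (p, p₀) (0, w)) _ p₀ :=
    hl.clm_apply (hasFDerivAt_const (0, w) p₀)
  have h1 : HasFDerivAt (fun q => fderiv ℝ m (p₀, q) (ζ, 0)) _ p₀ :=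
    hr.clm_apply (hasFDerivAt_const (ζ, 0) p₀)
  have h2 : HasFDerivAt (fun q => fderiv ℝ m (q, p₀) (0, b q)) _ p₀ :=
    hl.clm_apply ((hasFDerivAt_const (0 : E) p₀).prodMk hb)
  have h3 := DFunLike.congr_fun (h1.unique (h2.congr_of_eventuallyEq h)) η
  simp only [VectorField.lieBracket, (hX ζ).fderiv, (hX η).fderiv, hm0]
  have h4 := hsymm.eq (ζ, 0) (0, η)
  simp [hm0, hb0] at h3 h4 ⊢
  rw [h4, h3]
  abel

variable {G : Type*} [TopologicalSpace G] [ChartedSpace E G] [Group G]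

/-- The adjoint action `Ad(x⁻¹) ζ` as a map into the model space. -/
noncomputable def adInv (ζ : GroupLieAlgebra 𝓘(ℝ, E) G) (x : G) : E :=
  (mfderiv 𝓘(ℝ, E) 𝓘(ℝ, E) (fun y : G => x⁻¹ * y * x) 1 ζ :)

/-- Multiplication in the chart at the neutral element. -/
noncomputable def chartMul (E G : Type*) [NormedAddCommGroup E] [NormedSpace ℝ E]
    [TopologicalSpace G] [ChartedSpace E G] [Group G] (z : E × E) : E :=
  extChartAt 𝓘(ℝ, E) (1 : G)
    ((extChartAt 𝓘(ℝ, E) (1 : G)).symm z.1 * (extChartAt 𝓘(ℝ, E) (1 : G)).symm z.2)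

lemma fderiv_comp_extChartAt_symm {F : Type*} [NormedAddCommGroup F] [NormedSpace ℝ F]
    {f : G → F} {x : G} (hf : MDifferentiableAt 𝓘(ℝ, E) 𝓘(ℝ, F) f x) (w : E) :
    fderiv ℝ (f ∘ (extChartAt 𝓘(ℝ, E) x).symm) (extChartAt 𝓘(ℝ, E) x x) w
      = (mfderiv 𝓘(ℝ, E) 𝓘(ℝ, F) f x w :) := by
  have h : mfderiv 𝓘(ℝ, E) 𝓘(ℝ, F) f x = fderivWithin ℝ (writtenInExtChartAt 𝓘(ℝ, E) 𝓘(ℝ, F) x f)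
      (range 𝓘(ℝ, E)) (extChartAt 𝓘(ℝ, E) x x) := if_pos hf
  have h2 : writtenInExtChartAt 𝓘(ℝ, E) 𝓘(ℝ, F) x f = f ∘ (extChartAt 𝓘(ℝ, E) x).symm := rfl
  rw [h, h2, modelWithCornersSelf_coe, range_id, fderivWithin_univ]
  rfl

variable [LieGroup 𝓘(ℝ, E) ∞ G]

lemma mdifferentiable_right_mul (x : G) :
    MDifferentiable 𝓘(ℝ, E) 𝓘(ℝ, E) (fun y : G => y * x) :=
  (contMDiff_mul_right (I := 𝓘(ℝ, E)) (n := ∞) (a := x)).mdifferentiable (by simp)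

lemma contMDiff_adInv (ζ : GroupLieAlgebra 𝓘(ℝ, E) G) :
    ContMDiff 𝓘(ℝ, E) 𝓘(ℝ, E) ∞ (adInv ζ) := by
  have : IsManifold 𝓘(ℝ, E) 1 G := IsManifold.of_le (n := ∞) (by simp)
  have h : ContMDiff (𝓘(ℝ, E).prod 𝓘(ℝ, E)) 𝓘(ℝ, E) ∞ (uncurry fun x y : G => x⁻¹ * y * x) :=
    (((contMDiff_inv 𝓘(ℝ, E) ∞).comp contMDiff_fst).mul contMDiff_snd).mul contMDiff_fst
  let D : G → E →L[ℝ] E := fun x => (mfderiv 𝓘(ℝ, E) 𝓘(ℝ, E) (fun y => x⁻¹ * y * x) 1 :)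
  have hD : ContMDiff 𝓘(ℝ, E) 𝓘(ℝ, E →L[ℝ] E) ∞ D :=
    ContMDiff.mfderiv_at_const (m := ⊤) (p := (1 : G)) h (fun _ _ => by simp) fun _ => rfl
  exact hD.clm_apply (contMDiff_const (c := (show E from ζ)))

lemma adInv_one (ζ : GroupLieAlgebra 𝓘(ℝ, E) G) : adInv ζ 1 = ζ := by
  have h : (fun y : G => (1 : G)⁻¹ * y * 1) = id := by ext; simp
  simp only [adInv]
  rw [h, mfderiv_id]
  rfl

/-- Right-invariant fields in terms of left-invariant ones. -/
lemma mfderiv_comp_mul_right_eq {F : Type*} [NormedAddCommGroup F] [NormedSpace ℝ F]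
    {v : G → F} {x : G} (hv : MDifferentiableAt 𝓘(ℝ, E) 𝓘(ℝ, F) v x)
    (ζ : GroupLieAlgebra 𝓘(ℝ, E) G) :
    (mfderiv 𝓘(ℝ, E) 𝓘(ℝ, F) (fun y => v (y * x)) 1 ζ : F)
      = mfderiv 𝓘(ℝ, E) 𝓘(ℝ, F) (fun y => v (x * y)) 1 (adInv ζ x :) := by
  have h1 : MDifferentiableAt 𝓘(ℝ, E) 𝓘(ℝ, F) (fun y => v (x * y)) 1 :=
    MDifferentiableAt.comp_of_eq (1 : G) (f := fun y => x * y) hv (mdifferentiable_left_mul x _) (by simp)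
  have h2 : MDifferentiableAt 𝓘(ℝ, E) 𝓘(ℝ, E) (fun y : G => x⁻¹ * y * x) 1 :=
    (mdifferentiable_right_mul x _).comp 1 (mdifferentiable_left_mul x⁻¹ _)
  -- Chain rule for `y * x = x * (x⁻¹ * y * x)`.
  have h3 := mfderiv_comp_apply_of_eq (x := (1 : G)) (y := (1 : G)) (f := fun y => x⁻¹ * y * x)
    (g := fun y => v (x * y)) h1 h2 (by simp) ζ
  have h4 : (fun y => v (x * y)) ∘ (fun y => x⁻¹ * y * x) = fun y => v (y * x) := by
    ext y
    simp [mul_assoc]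
  rw [h4] at h3
  exact h3

lemma contDiffAt_chartMul :
    ContDiffAt ℝ ∞ (chartMul E G)
      (extChartAt 𝓘(ℝ, E) (1 : G) 1, extChartAt 𝓘(ℝ, E) (1 : G) 1) := by
  rw [← contMDiffAt_iff_contDiffAt]
  have hs : ContMDiffAt 𝓘(ℝ, E) 𝓘(ℝ, E) ∞ (extChartAt 𝓘(ℝ, E) (1 : G)).symm
      (extChartAt 𝓘(ℝ, E) (1 : G) 1) :=
    (contMDiffOn_extChartAt_symm (1 : G)).contMDiffAt (extChartAt_target_mem_nhds 1)
  have h1 : ContMDiffAt 𝓘(ℝ, E × E) 𝓘(ℝ, E) ∞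
      (fun z : E × E => (extChartAt 𝓘(ℝ, E) (1 : G)).symm z.1)
      (extChartAt 𝓘(ℝ, E) (1 : G) 1, extChartAt 𝓘(ℝ, E) (1 : G) 1) :=
    hs.comp_of_eq (contDiff_fst.contMDiff.contMDiffAt) rfl
  have h2 : ContMDiffAt 𝓘(ℝ, E × E) 𝓘(ℝ, E) ∞
      (fun z : E × E => (extChartAt 𝓘(ℝ, E) (1 : G)).symm z.2)
      (extChartAt 𝓘(ℝ, E) (1 : G) 1, extChartAt 𝓘(ℝ, E) (1 : G) 1) :=
    hs.comp_of_eq (contDiff_snd.contMDiff.contMDiffAt) rfl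
  have h3 := h1.mul h2
  exact ContMDiffAt.comp_of_eq (x := (extChartAt 𝓘(ℝ, E) (1 : G) 1, extChartAt 𝓘(ℝ, E) (1 : G) 1))
    (contMDiffAt_extChartAt (I := 𝓘(ℝ, E)) (n := ∞) (x := (1 : G))) h3 (by simp)

lemma fderiv_chartMul_right {p : E}
    (hp : (extChartAt 𝓘(ℝ, E) (1 : G)).symm p ∈ (chartAt E (1 : G)).source)
    (hm : DifferentiableAt ℝ (chartMul E G) (p, extChartAt 𝓘(ℝ, E) (1 : G) 1)) (w : E) :
    fderiv ℝ (chartMul E G) (p, extChartAt 𝓘(ℝ, E) (1 : G) 1) (0, w)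
      = (mfderiv 𝓘(ℝ, E) 𝓘(ℝ, E) (fun y => extChartAt 𝓘(ℝ, E) (1 : G)
          ((extChartAt 𝓘(ℝ, E) (1 : G)).symm p * y)) 1 w :) := by
  have : IsManifold 𝓘(ℝ, E) 1 G := IsManifold.of_le (n := ∞) (by simp)
  have h1 : MDifferentiableAt 𝓘(ℝ, E) 𝓘(ℝ, E) (fun y => extChartAt 𝓘(ℝ, E) (1 : G)
      ((extChartAt 𝓘(ℝ, E) (1 : G)).symm p * y)) 1 :=
    MDifferentiableAt.comp_of_eq (1 : G) (mdifferentiableAt_extChartAt hp) (mdifferentiable_left_mul _ _)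
      (by simp)
  rw [← fderiv_comp_extChartAt_symm h1]
  have h2 := (hm.hasFDerivAt.comp (f := fun q => (p, q)) _ (hasFDerivAt_prodMk_right p _)).fderiv
  exact (DFunLike.congr_fun h2 w).symm

lemma fderiv_chartMul_left {q : E}
    (hq : (extChartAt 𝓘(ℝ, E) (1 : G)).symm q ∈ (chartAt E (1 : G)).source)
    (hm : DifferentiableAt ℝ (chartMul E G) (extChartAt 𝓘(ℝ, E) (1 : G) 1, q)) (w : E) :
    fderiv ℝ (chartMul E G) (extChartAt 𝓘(ℝ, E) (1 : G) 1, q) (w, 0)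
      = (mfderiv 𝓘(ℝ, E) 𝓘(ℝ, E) (fun y => extChartAt 𝓘(ℝ, E) (1 : G)
          (y * (extChartAt 𝓘(ℝ, E) (1 : G)).symm q)) 1 w :) := by
  have : IsManifold 𝓘(ℝ, E) 1 G := IsManifold.of_le (n := ∞) (by simp)
  have h1 : MDifferentiableAt 𝓘(ℝ, E) 𝓘(ℝ, E) (fun y => extChartAt 𝓘(ℝ, E) (1 : G)
      (y * (extChartAt 𝓘(ℝ, E) (1 : G)).symm q)) 1 :=
    MDifferentiableAt.comp_of_eq (1 : G) (mdifferentiableAt_extChartAt hq) (mdifferentiable_right_mul _ _)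
      (by simp)
  rw [← fderiv_comp_extChartAt_symm h1]
  have h2 := (hm.hasFDerivAt.comp (f := fun p => (p, q)) _ (hasFDerivAt_prodMk_left _ q)).fderiv
  exact (DFunLike.congr_fun h2 w).symm

/-- A left-invariant field in the chart at the neutral element. -/
lemma mpullbackWithin_mulInvariantVectorField {p : E}
    (hp : p ∈ (extChartAt 𝓘(ℝ, E) (1 : G)).target)
    (hm : DifferentiableAt ℝ (chartMul E G) (p, extChartAt 𝓘(ℝ, E) (1 : G) 1))
    (η : GroupLieAlgebra 𝓘(ℝ, E) G) :
    VectorField.mpullbackWithin 𝓘(ℝ, E) 𝓘(ℝ, E) (extChartAt 𝓘(ℝ, E) (1 : G)).symm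
      (mulInvariantVectorField η) (range 𝓘(ℝ, E)) p
    = fderiv ℝ (chartMul E G) (p, extChartAt 𝓘(ℝ, E) (1 : G) 1) ((0 : E), (show E from η)) := by
  have : IsManifold 𝓘(ℝ, E) 1 G := IsManifold.of_le (n := ∞) (by simp)
  have hp' : (extChartAt 𝓘(ℝ, E) (1 : G)).symm p ∈ (chartAt E (1 : G)).source := by
    simpa using (extChartAt 𝓘(ℝ, E) (1 : G)).map_target hp
  rw [fderiv_chartMul_right hp' hm, VectorField.mpullbackWithin_apply,
    ContinuousLinearMap.inverse_eq (mfderivWithin_extChartAt_symm_comp_mfderiv_extChartAt hp)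
      (mfderiv_extChartAt_comp_mfderivWithin_extChartAt_symm hp)]
  exact (mfderiv_comp_apply_of_eq (x := (1 : G)) (mdifferentiableAt_extChartAt hp')
    (mdifferentiable_left_mul _ _) (by simp) η).symm

/-- The chart at `1` has identity differential there, so the Lie algebra bracket is the vector-space
bracket of the two fields read in that chart. The chart computation above then applies with `b` the
chart expression of `adInv ζ`. -/
lemma mfderiv_adInv_one [CompleteSpace E] (ζ η : GroupLieAlgebra 𝓘(ℝ, E) G) :
    (mfderiv 𝓘(ℝ, E) 𝓘(ℝ, E) (adInv ζ : G → E) 1 η : E) = (⁅ζ, η⁆ : GroupLieAlgebra 𝓘(ℝ, E) G) := by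
  have : IsManifold 𝓘(ℝ, E) 1 G := IsManifold.of_le (n := ∞) (by simp)
  set p₀ : E := extChartAt 𝓘(ℝ, E) (1 : G) 1 with hp₀
  have hm : ContDiffAt ℝ 2 (chartMul E G) (p₀, p₀) :=
    contDiffAt_chartMul.of_le (WithTop.coe_le_coe.2 (le_top : (2 : ℕ∞) ≤ ⊤))
  have htarget : ∀ᶠ p in nhds p₀, p ∈ (extChartAt 𝓘(ℝ, E) (1 : G)).target :=
    extChartAt_target_mem_nhds 1
  have hsource {p : E} (hp : p ∈ (extChartAt 𝓘(ℝ, E) (1 : G)).target) :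
      (extChartAt 𝓘(ℝ, E) (1 : G)).symm p ∈ (chartAt E (1 : G)).source := by
    simpa using (extChartAt 𝓘(ℝ, E) (1 : G)).map_target hp
  have hdiff : ∀ᶠ z in nhds (p₀, p₀), DifferentiableAt ℝ (chartMul E G) z :=
    (hm.eventually (by simp)).mono fun z hz => hz.differentiableAt (by simp)
  have hl : ∀ᶠ p in nhds p₀, DifferentiableAt ℝ (chartMul E G) (p, p₀) :=
    (Continuous.prodMk_left p₀).continuousAt.eventually hdiff
  have hr : ∀ᶠ q in nhds p₀, DifferentiableAt ℝ (chartMul E G) (p₀, q) :=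
    (Continuous.prodMk_right p₀).continuousAt.eventually hdiff
  have hX (w : GroupLieAlgebra 𝓘(ℝ, E) G) :
      VectorField.mpullbackWithin 𝓘(ℝ, E) 𝓘(ℝ, E) (extChartAt 𝓘(ℝ, E) (1 : G)).symm
        (mulInvariantVectorField w) (range 𝓘(ℝ, E))
      =ᶠ[nhds p₀] fun p => fderiv ℝ (chartMul E G) (p, p₀) ((0 : E), (show E from w)) := by
    filter_upwards [htarget, hl] with p h1 h2
    exact mpullbackWithin_mulInvariantVectorField h1 h2 w
  have hsymm0 : (extChartAt 𝓘(ℝ, E) (1 : G)).symm p₀ = 1 := by simp [hp₀]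
  have hs : ContMDiffAt 𝓘(ℝ, E) 𝓘(ℝ, E) ∞ (extChartAt 𝓘(ℝ, E) (1 : G)).symm p₀ :=
    (contMDiffOn_extChartAt_symm (1 : G)).contMDiffAt (extChartAt_target_mem_nhds 1)
  have hb : HasFDerivAt (adInv ζ ∘ (extChartAt 𝓘(ℝ, E) (1 : G)).symm)
      (fderiv ℝ (adInv ζ ∘ (extChartAt 𝓘(ℝ, E) (1 : G)).symm) p₀) p₀ :=
    ((contMDiff_adInv ζ).contMDiffAt.comp p₀ hs).contDiffAt.differentiableAt (by simp)
      |>.hasFDerivAt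
  have h0 (w : E) : fderiv ℝ (chartMul E G) (p₀, p₀) (0, w) = w := by
    rw [fderiv_chartMul_right (hsource htarget.self_of_nhds) hl.self_of_nhds, hsymm0]
    have h1 : (fun y : G => extChartAt 𝓘(ℝ, E) (1 : G) (1 * y)) = extChartAt 𝓘(ℝ, E) (1 : G) := by
      ext y
      rw [one_mul]
    rw [h1, mfderiv_extChartAt_self]
    rfl
  have key := lieBracket_fderiv_eq_of_eventually_eq (ζ := (show E from ζ)) (η := (show E from η))
    hm h0 hb (by simp only [comp_apply, hsymm0]; exact adInv_one ζ) (by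
      filter_upwards [htarget, hl, hr] with q h1 h2 h3
      refine (fderiv_chartMul_left (hsource h1) h3 _).trans
        (Eq.trans ?_ (fderiv_chartMul_right (hsource h1) h2 _).symm)
      exact mfderiv_comp_mul_right_eq (mdifferentiableAt_extChartAt (hsource h1)) ζ)
  rw [fderiv_comp_extChartAt_symm ((contMDiff_adInv ζ).mdifferentiable (by simp) 1)] at key
  have hinv (w : E) : ContinuousLinearMap.inverse
      (mfderiv 𝓘(ℝ, E) 𝓘(ℝ, E) (extChartAt 𝓘(ℝ, E) (1 : G)) 1 : E →L[ℝ] E) w = w := by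
    have h1 : (mfderiv 𝓘(ℝ, E) 𝓘(ℝ, E) (extChartAt 𝓘(ℝ, E) (1 : G)) 1 : E →L[ℝ] E)
      = ContinuousLinearMap.id ℝ E := mfderiv_extChartAt_self
    exact (congrArg (fun L : E →L[ℝ] E => ContinuousLinearMap.inverse L w) h1).trans
      (DFunLike.congr_fun ContinuousLinearMap.inverse_id w)
  rw [GroupLieAlgebra.bracket_def, ← VectorField.mlieBracketWithin_univ,
    VectorField.mlieBracketWithin_apply]
  refine Eq.trans ?_ (hinv _).symm
  have h1 := (hX ζ).lieBracket_vectorField_eq (𝕜 := ℝ) (hX η)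
  rw [preimage_univ, univ_inter, modelWithCornersSelf_coe, range_id]
  rw [modelWithCornersSelf_coe, range_id] at h1
  exact (h1.trans key).symm.trans (congrFun (VectorField.lieBracketWithin_univ (𝕜 := ℝ)) _).symm

end InvariantFields

/-! ### The divergence is the trace of `ad`, and it vanishes on the horizontal layer. -/

section Divergence

variable {E G : Type*} [NormedAddCommGroup E] [NormedSpace ℝ E] [FiniteDimensional ℝ E]
  [TopologicalSpace G] [T2Space G] [SecondCountableTopology G]
  [ChartedSpace E G] [Group G] [LieGroup 𝓘(ℝ, E) ∞ G]

lemma mdifferentiable_inv :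
    MDifferentiable 𝓘(ℝ, E) 𝓘(ℝ, E) (fun y : G => y⁻¹) :=
  (contMDiff_inv 𝓘(ℝ, E) ∞).mdifferentiable (by simp)

/-- Inversion is an involution fixing `1`, so its differential there is its own inverse. -/
lemma exists_mfderiv_inv_eq (ζ : GroupLieAlgebra 𝓘(ℝ, E) G) :
    ∃ ξ : GroupLieAlgebra 𝓘(ℝ, E) G,
      (mfderiv 𝓘(ℝ, E) 𝓘(ℝ, E) (fun y : G => y⁻¹) 1 ξ : E) = ζ := by
  refine ⟨(mfderiv 𝓘(ℝ, E) 𝓘(ℝ, E) (fun y : G => y⁻¹) 1 ζ : E), ?_⟩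
  have h := mfderiv_comp_apply_of_eq (x := (1 : G)) (y := (1 : G)) (f := fun y : G => y⁻¹)
    (g := fun y : G => y⁻¹) (mdifferentiable_inv (E := E) 1) (mdifferentiable_inv (E := E) 1)
    (by simp) ζ
  have h2 : (fun y : G => y⁻¹) ∘ (fun y : G => y⁻¹) = id := by ext; simp
  rw [h2, mfderiv_id] at h
  exact h.symm

/-- The derivative of the adjoint action at the neutral element. -/
noncomputable def adDeriv (ζ : GroupLieAlgebra 𝓘(ℝ, E) G) : E →ₗ[ℝ] E :=
  ContinuousLinearMap.toLinearMap (M := E) (M₂ := E) (mfderiv 𝓘(ℝ, E) 𝓘(ℝ, E) (adInv ζ : G → E) 1)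

lemma adDeriv_apply (ζ η : GroupLieAlgebra 𝓘(ℝ, E) G) :
    adDeriv ζ (show E from η) = (⁅ζ, η⁆ : GroupLieAlgebra 𝓘(ℝ, E) G) :=
  have := FiniteDimensional.complete ℝ E
  mfderiv_adInv_one ζ η

/-- Bracketing with a horizontal vector moves layer `i` into layer `i + 1` and kills the last layer,
so `S.step` applications annihilate every layer, and the layers span. -/
lemma isNilpotent_adDeriv (S : Stratification E G) {ζ : GroupLieAlgebra 𝓘(ℝ, E) G}
    (hζ : ζ ∈ S.horizontal) : IsNilpotent (adDeriv ζ : E →ₗ[ℝ] E) := by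
  have hstep {i : ℕ} {w : GroupLieAlgebra 𝓘(ℝ, E) G} (hw : w ∈ S.layer i) :
      (adDeriv ζ (show E from w) : GroupLieAlgebra 𝓘(ℝ, E) G)
        ∈ bracketSpan (S.layer 1) (S.layer i) := by
    refine Submodule.subset_span ⟨ζ, hζ, w, hw, ?_⟩
    exact (adDeriv_apply ζ w).symm
  have hkill : ∀ k i : ℕ, 1 ≤ i → i ≤ S.step → S.step < k + i →
      ∀ w : GroupLieAlgebra 𝓘(ℝ, E) G, w ∈ S.layer i →
        ((adDeriv ζ : E →ₗ[ℝ] E) ^ k) (show E from w) = 0 := by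
    intro k
    induction k with
    | zero => intro i _ h1 h2; omega
    | succ k ih =>
      intro i h1 h2 h3 w hw
      rw [pow_succ, Module.End.mul_apply]
      have h4 := hstep hw
      rcases h2.eq_or_lt with h5 | h5
      · rw [h5, S.bracket_last] at h4
        have h6 : adDeriv ζ (show E from w) = (0 : E) := h4
        rw [h6, map_zero]
      · rw [S.bracket_layer i h1 h5] at h4
        exact ih (i + 1) (by omega) h5 (by omega) _ h4
  refine ⟨S.step, ?_⟩
  let K : Submodule ℝ (GroupLieAlgebra 𝓘(ℝ, E) G) :=
    LinearMap.ker ((adDeriv ζ : E →ₗ[ℝ] E) ^ S.step)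
  have hK : (⊤ : Submodule ℝ (GroupLieAlgebra 𝓘(ℝ, E) G)) ≤ K := by
    rw [← S.isInternal.submodule_iSup_eq_top]
    exact iSup_le fun i w hw => hkill S.step (i + 1) (by omega) (by omega) (by omega) w hw
  ext w
  exact hK (Submodule.mem_top (x := (w : GroupLieAlgebra 𝓘(ℝ, E) G)))

variable [MeasurableSpace G] [BorelSpace G]

/-- The variable vector `adInv ζ x` turns the left-invariant derivative into the right-invariant
one, whose flow consists of left translations and preserves `μ`. Inversion reduces this to a
left-invariant field and the right-invariant measure `μ.inv`. -/
lemma integral_leftInvDeriv_adInv (μ : Measure G) [μ.IsHaarMeasure]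
    (ζ : GroupLieAlgebra 𝓘(ℝ, E) G) {v : G → ℝ}
    (hv : ContMDiff 𝓘(ℝ, E) 𝓘(ℝ, ℝ) ∞ v) (hc : HasCompactSupport v) :
    ∫ x, leftInvDeriv (adInv ζ x :) v x ∂μ = 0 := by
  have : IsTopologicalGroup G := topologicalGroup_of_lieGroup 𝓘(ℝ, E) ∞
  obtain ⟨ξ, hξ⟩ := exists_mfderiv_inv_eq (E := E) ζ
  have hvd : MDifferentiable 𝓘(ℝ, E) 𝓘(ℝ, ℝ) v := hv.mdifferentiable (by simp)
  have hw : ContMDiff 𝓘(ℝ, E) 𝓘(ℝ, ℝ) ∞ (fun y => v y⁻¹) := hv.comp (contMDiff_inv 𝓘(ℝ, E) ∞)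
  have h1 := integral_leftInvDeriv_of_isMulRightInvariant μ.inv ξ hw
    (hc.comp_homeomorph (Homeomorph.inv G))
  have h2 : ∫ x, leftInvDeriv ξ (fun y => v y⁻¹) x ∂μ.inv
      = ∫ x, leftInvDeriv ξ (fun y => v y⁻¹) x⁻¹ ∂μ :=
    (Homeomorph.inv G).measurableEmbedding.integral_map _
  rw [← h1, h2]
  congr 1
  ext x
  rw [leftInvDeriv_eq ξ (hw.mdifferentiable (by simp))]
  refine (leftInvDeriv_eq _ hvd x).trans ?_
  refine (mfderiv_comp_mul_right_eq (hvd x) ζ).symm.trans ?_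
  have h3 := mfderiv_comp_apply_of_eq (x := (1 : G)) (y := (1 : G)) (f := fun y : G => y⁻¹)
    (g := fun y : G => v (y * x)) ((hvd _).comp _ (mdifferentiable_right_mul x 1))
    (mdifferentiable_inv (E := E) 1) (by simp) ξ
  have h4 : (fun y : G => v (y * x)) ∘ (fun y : G => y⁻¹) = fun y => v (x⁻¹ * y)⁻¹ := by
    ext y; simp
  rw [h4] at h3
  refine Eq.trans ?_ h3.symm
  rw [← hξ]

/-- The divergence of a left-invariant vector field is the trace of the adjoint action. -/
lemma integral_leftInvDeriv_eq_trace_mul (μ : Measure G) [μ.IsHaarMeasure]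
    (ζ : GroupLieAlgebra 𝓘(ℝ, E) G) {v : G → ℝ}
    (hv : ContMDiff 𝓘(ℝ, E) 𝓘(ℝ, ℝ) ∞ v) (hc : HasCompactSupport v) :
    ∫ x, leftInvDeriv ζ v x ∂μ = LinearMap.trace ℝ E (adDeriv ζ) * ∫ x, v x ∂μ := by
  have : IsTopologicalGroup G := topologicalGroup_of_lieGroup 𝓘(ℝ, E) ∞
  have : LocallyCompactSpace G := Manifold.locallyCompact_of_finiteDimensional 𝓘(ℝ, E)
  have : IsManifold 𝓘(ℝ, E) ∞ G := inferInstance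
  obtain ⟨c, hcdiv⟩ := exists_integral_leftInvDeriv_eq_mul (E := E) μ
  rw [hcdiv ζ v hv hc]
  congr 1
  let b := Module.finBasis ℝ E
  let X : Fin (Module.finrank ℝ E) → GroupLieAlgebra 𝓘(ℝ, E) G := fun j => b j
  let a : Fin (Module.finrank ℝ E) → G → ℝ := fun j x => b.coord j (adInv ζ x)
  have ha (j) : ContMDiff 𝓘(ℝ, E) 𝓘(ℝ, ℝ) ∞ (a j) :=
    (LinearMap.toContinuousLinearMap (b.coord j)).contMDiff.comp (contMDiff_adInv ζ)
  have hsum (x : G) : ∑ j, a j x • X j = adInv ζ x := b.sum_repr (adInv ζ x)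
  -- Minus the right-invariant field of `ζ` is formally `-∑ a j • X j`; by the product rule and the
  -- constant divergences `c (X j)`, the integral of `∑ a j • X j` applied to a test function `g` is
  -- `∫ g h`. That integral is zero, so `h` vanishes identically.
  let h : G → ℝ := fun x => ∑ j, (c (X j) * a j x - leftInvDeriv (X j) (a j) x)
  have hh : Continuous h := by
    refine continuous_finsetSum _ fun j _ => ?_
    exact ((ha j).continuous.const_mul _).sub (contMDiff_leftInvDeriv _ (ha j)).continuous
  have hzero : h = fun _ => 0 := by
    refine (Continuous.ae_eq_iff_eq μ hh continuous_const).1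
      (ae_eq_zero_of_integral_contMDiff_smul_eq_zero 𝓘(ℝ, E) hh.locallyIntegrable
        fun g hg hgc => ?_)
    have h1 := integral_leftInvDeriv_adInv μ ζ hg hgc
    have hgd := hg.mdifferentiable (by simp)
    have hi1 (j) : Integrable (leftInvDeriv (X j) (fun y => a j y * g y)) μ :=
      (contMDiff_leftInvDeriv _ ((ha j).mul hg)).continuous.integrable_of_hasCompactSupport
        ((hgc.mul_left (f := a j)).leftInvDeriv (X j))
    have hi2 (j) : Integrable (fun x => g x * leftInvDeriv (X j) (a j) x) μ :=
      (hg.continuous.mul (contMDiff_leftInvDeriv _ (ha j)).continuous).integrable_of_hasCompactSupport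
        (hgc.mul_right)
    have hi3 (j) : Integrable (fun x => a j x * g x) μ :=
      ((ha j).continuous.mul hg.continuous).integrable_of_hasCompactSupport hgc.mul_left
    have h2 (x : G) : leftInvDeriv (adInv ζ x :) g x = ∑ j,
        (leftInvDeriv (X j) (fun y => a j y * g y) x - g x * leftInvDeriv (X j) (a j) x) := by
      have h3 (s : Finset (Fin (Module.finrank ℝ E))) :
          leftInvDeriv (∑ j ∈ s, a j x • X j) g x = ∑ j ∈ s, a j x * leftInvDeriv (X j) g x := by
        classical
        induction s using Finset.induction_on with
        | empty => simpa using leftInvDeriv_smul_left 0 (0 : GroupLieAlgebra 𝓘(ℝ, E) G) g x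
        | insert i s hi ih =>
          rw [Finset.sum_insert hi, Finset.sum_insert hi, leftInvDeriv_add_left,
            leftInvDeriv_smul_left, ih]
      refine (congrArg (fun w => leftInvDeriv w g x) (hsum x)).symm.trans ((h3 _).trans ?_)
      refine Finset.sum_congr rfl fun j _ => ?_
      rw [leftInvDeriv_mul _ ((ha j).mdifferentiable (by simp)) hgd]
      ring
    simp_rw [h2] at h1
    rw [integral_finsetSum (f := fun j x => leftInvDeriv (X j) (fun y => a j y * g y) x
      - g x * leftInvDeriv (X j) (a j) x) _ fun j _ => (hi1 j).sub (hi2 j)] at h1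
    simp only [h, smul_eq_mul, Finset.mul_sum]
    rw [integral_finsetSum _ fun j _ => ?_, ← h1]
    · refine Finset.sum_congr rfl fun j _ => ?_
      rw [integral_sub (hi1 j) (hi2 j), hcdiv (X j) (fun y => a j y * g y) ((ha j).mul hg) hgc.mul_left,
        ← integral_const_mul, ← integral_sub ((hi3 j).const_mul _) (hi2 j)]
      congr 1
      ext x
      ring
    · convert ((hi3 j).const_mul (c (X j))).sub (hi2 j) using 1
      ext x
      simp only [Pi.sub_apply]
      ring
  -- At the neutral element, where `adInv ζ 1 = ζ`, the first sum in `h` is `c ζ` and the second is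
  -- the trace of `adDeriv ζ`.
  have h1 : h 1 = 0 := congrFun hzero 1
  have h2 : c ζ = ∑ j, c (X j) * a j 1 := by
    have h3 := congrArg c ((hsum 1).trans (adInv_one ζ))
    rw [← h3, map_sum]
    refine Finset.sum_congr rfl fun j _ => ?_
    rw [map_smul, smul_eq_mul, mul_comm]
  have h3 (j) : leftInvDeriv (X j) (a j) 1 = b.coord j (adDeriv ζ (b j)) := by
    have h4 : (fun y => a j (1 * y)) = a j := by
      ext y
      rw [one_mul]
    rw [leftInvDeriv_eq _ ((ha j).mdifferentiable (by simp)), h4]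
    refine (mfderiv_comp_apply_of_eq (x := (1 : G)) (f := adInv ζ)
      (LinearMap.toContinuousLinearMap (b.coord j)).mdifferentiableAt
      ((contMDiff_adInv ζ).mdifferentiable (by simp) 1) rfl (X j)).trans ?_
    exact DFunLike.congr_fun (ContinuousLinearMap.mfderiv_eq _) _
  simp only [h, Finset.sum_sub_distrib, ← h2, h3] at h1
  rw [sub_eq_zero.1 h1, LinearMap.trace_eq_matrix_trace ℝ b]
  simp [Matrix.trace, LinearMap.toMatrix_apply]

lemma integral_leftInvDeriv_eq_zero (S : Stratification E G) (μ : Measure G) [μ.IsHaarMeasure]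
    {ζ : GroupLieAlgebra 𝓘(ℝ, E) G} (hζ : ζ ∈ S.horizontal) {v : G → ℝ}
    (hv : ContMDiff 𝓘(ℝ, E) 𝓘(ℝ, ℝ) ∞ v) (hc : HasCompactSupport v) :
    ∫ x, leftInvDeriv ζ v x ∂μ = 0 := by
  rw [integral_leftInvDeriv_eq_trace_mul μ ζ hv hc,
    (LinearMap.isNilpotent_trace_of_isNilpotent (isNilpotent_adDeriv S hζ)).eq_zero, zero_mul]

end Divergence

/-! ### Linearity of the horizontal gradient and its invariance under adding constants. -/

section Gradient

variable {E G : Type*} [NormedAddCommGroup E] [NormedSpace ℝ E] [FiniteDimensional ℝ E]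
  [TopologicalSpace G] [T2Space G] [SecondCountableTopology G]
  [ChartedSpace E G] [Group G] [LieGroup 𝓘(ℝ, E) ∞ G]
  [MeasurableSpace G] [BorelSpace G]
  {μ : Measure G} {Ω : Set G}

lemma MeasureTheory.LocallyIntegrableOn.integrableOn_mul_of_tsupport_subset {u v : G → ℝ}
    (hu : LocallyIntegrableOn u Ω μ) (hv : Continuous v) (hc : HasCompactSupport v)
    (hs : tsupport v ⊆ Ω) : IntegrableOn (fun x => u x * v x) Ω μ := by
  have h1 : IntegrableOn (fun x => u x * v x) (tsupport v) μ :=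
    (hu.integrableOn_compact_subset hs hc).mul_continuousOn hv.continuousOn hc
  refine IntegrableOn.mono_set ((integrableOn_iff_integrable_of_support_subset ?_).1 h1
    |>.integrableOn) (subset_univ Ω)
  intro x hx
  exact subset_tsupport v fun h0 => hx (by simp [h0])

lemma tsupport_leftInvDeriv_subset (ξ : GroupLieAlgebra 𝓘(ℝ, E) G) (v : G → ℝ) :
    tsupport (leftInvDeriv ξ v) ⊆ tsupport v := by
  refine closure_minimal (fun x hx => ?_) (isClosed_tsupport v)
  by_contra h
  exact hx (leftInvDeriv_eq_zero_of_notMem_tsupport ξ h)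

lemma MeasureTheory.LocallyIntegrableOn.integrableOn_mul_leftInvDeriv {u v : G → ℝ}
    (hu : LocallyIntegrableOn u Ω μ) (ξ : GroupLieAlgebra 𝓘(ℝ, E) G)
    (hv : ContMDiff 𝓘(ℝ, E) 𝓘(ℝ, ℝ) ∞ v) (hc : HasCompactSupport v) (hs : tsupport v ⊆ Ω) :
    IntegrableOn (fun x => u x * leftInvDeriv ξ v x) Ω μ :=
  hu.integrableOn_mul_of_tsupport_subset (contMDiff_leftInvDeriv ξ hv).continuous
    (hc.leftInvDeriv ξ) ((tsupport_leftInvDeriv_subset ξ v).trans hs)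

lemma IsGeneralizedDeriv.add {ξ : GroupLieAlgebra 𝓘(ℝ, E) G} {u₁ u₂ w₁ w₂ : G → ℝ}
    (hu₁ : LocallyIntegrableOn u₁ Ω μ) (hu₂ : LocallyIntegrableOn u₂ Ω μ)
    (h₁ : IsGeneralizedDeriv μ Ω ξ u₁ w₁) (h₂ : IsGeneralizedDeriv μ Ω ξ u₂ w₂) :
    IsGeneralizedDeriv μ Ω ξ (fun x => u₁ x + u₂ x) (fun x => w₁ x + w₂ x) := by
  refine ⟨h₁.1.add h₂.1, fun v hv hc hs => ?_⟩
  simp_rw [add_mul]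
  rw [integral_add (h₁.1.integrableOn_mul_of_tsupport_subset hv.continuous hc hs)
      (h₂.1.integrableOn_mul_of_tsupport_subset hv.continuous hc hs),
    integral_add (hu₁.integrableOn_mul_leftInvDeriv ξ hv hc hs)
      (hu₂.integrableOn_mul_leftInvDeriv ξ hv hc hs), h₁.2 v hv hc hs, h₂.2 v hv hc hs]
  ring

lemma IsGeneralizedDeriv.const_mul {ξ : GroupLieAlgebra 𝓘(ℝ, E) G} {u w : G → ℝ} (r : ℝ)
    (h : IsGeneralizedDeriv μ Ω ξ u w) :
    IsGeneralizedDeriv μ Ω ξ (fun x => r * u x) (fun x => r * w x) := by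
  refine ⟨h.1.smul r, fun v hv hc hs => ?_⟩
  simp_rw [mul_assoc]
  rw [integral_const_mul, integral_const_mul, h.2 v hv hc hs]
  ring

/-- This is where the vanishing divergence of horizontal fields is needed. -/
lemma isGeneralizedDeriv_const (S : Stratification E G) [μ.IsHaarMeasure] [LocallyCompactSpace G]
    {ξ : GroupLieAlgebra 𝓘(ℝ, E) G} (hξ : ξ ∈ S.horizontal) (r : ℝ) :
    IsGeneralizedDeriv μ Ω ξ (fun _ => r) (fun _ => 0) := by
  refine ⟨(locallyIntegrable_const (0 : ℝ)).locallyIntegrableOn Ω, fun v hv hc hs => ?_⟩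
  simp only [zero_mul, integral_zero]
  rw [integral_const_mul, setIntegral_eq_integral_of_forall_compl_eq_zero fun x hx =>
    leftInvDeriv_eq_zero_of_notMem_tsupport ξ fun h => hx (hs h),
    integral_leftInvDeriv_eq_zero S μ hξ hv hc]
  simp

variable {n : ℕ} {V : Submodule ℝ (GroupLieAlgebra 𝓘(ℝ, E) G)} {X : Module.Basis (Fin n) ℝ V}
  {q : ℝ≥0∞}

lemma MemHomSobolev.isHorizontalGradient {u : G → ℝ} (hu : MemHomSobolev q μ Ω X u) :
    IsHorizontalGradient μ Ω X u (horizontalGradient μ Ω X u) := by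
  obtain ⟨-, g, hg, -⟩ := hu
  have h : ∃ g, IsHorizontalGradient μ Ω X u g := ⟨g, hg⟩
  rw [horizontalGradient, dif_pos h]
  exact h.choose_spec

variable [LocallyCompactSpace G]

lemma MemHomSobolev.memLp {u : G → ℝ} (hΩ : IsOpen Ω) (hu : MemHomSobolev q μ Ω X u) :
    MemLp (horizontalGradient μ Ω X u) q (μ.restrict Ω) := by
  obtain ⟨-, g, hg, hgq⟩ := id hu
  exact (memLp_congr_ae (hg.ae_eq hΩ hu.isHorizontalGradient)).1 hgq

lemma horizontalGradient_add {u₁ u₂ u₃ : G → ℝ} (hΩ : IsOpen Ω) (h₁ : MemHomSobolev q μ Ω X u₁)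
    (h₂ : MemHomSobolev q μ Ω X u₂) (h₃ : MemHomSobolev q μ Ω X u₃) (h : ∀ x, u₃ x = u₁ x + u₂ x) :
    horizontalGradient μ Ω X u₃ =ᵐ[μ.restrict Ω]
      horizontalGradient μ Ω X u₁ + horizontalGradient μ Ω X u₂ := by
  refine h₃.isHorizontalGradient.ae_eq hΩ fun j => ?_
  rw [funext h]
  exact IsGeneralizedDeriv.add h₁.1 h₂.1 (h₁.isHorizontalGradient j) (h₂.isHorizontalGradient j)

lemma horizontalGradient_const_mul {u₁ u₂ : G → ℝ} (hΩ : IsOpen Ω) (h₁ : MemHomSobolev q μ Ω X u₁)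
    (h₂ : MemHomSobolev q μ Ω X u₂) (r : ℝ) (h : ∀ x, u₂ x = r * u₁ x) :
    horizontalGradient μ Ω X u₂ =ᵐ[μ.restrict Ω] r • horizontalGradient μ Ω X u₁ := by
  refine h₂.isHorizontalGradient.ae_eq hΩ fun j => ?_
  rw [funext h]
  exact (h₁.isHorizontalGradient j).const_mul r

lemma horizontalGradient_add_const (S : Stratification E G) [μ.IsHaarMeasure]
    {X : Module.Basis (Fin n) ℝ S.horizontal} {u₁ u₂ : G → ℝ} (hΩ : IsOpen Ω)
    (h₁ : MemHomSobolev q μ Ω X u₁) (h₂ : MemHomSobolev q μ Ω X u₂) (r : ℝ)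
    (h : ∀ x, u₂ x = u₁ x + r) :
    horizontalGradient μ Ω X u₂ =ᵐ[μ.restrict Ω] horizontalGradient μ Ω X u₁ := by
  refine h₂.isHorizontalGradient.ae_eq hΩ fun j => ?_
  rw [funext h]
  simpa using IsGeneralizedDeriv.add h₁.1 ((locallyIntegrable_const r).locallyIntegrableOn Ω)
    (h₁.isHorizontalGradient j) (isGeneralizedDeriv_const S (X j).2 r)

end Gradient

/-! ### Lipschitz functions modulo constants as a Banach space. -/

section LipschitzQuotients

/-- The bounded functions on `Y × Y` that are difference quotients of a function on `Y` off the
diagonal: the Banach space `Lip(Y)` modulo constants, with a harmless freedom on the diagonal. -/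
noncomputable def lipQuotients (Y : Type*) [MetricSpace Y] :
    Submodule ℝ (lp (fun _ : Y × Y => ℝ) ∞) :=
  ⨅ t : Y × Y × Y, LinearMap.ker (ContinuousLinearMap.toLinearMap
    (dist t.1 t.2.1 • lp.evalCLM ℝ (fun _ : Y × Y => ℝ) ∞ (t.1, t.2.1)
      + dist t.2.1 t.2.2 • lp.evalCLM ℝ (fun _ : Y × Y => ℝ) ∞ (t.2.1, t.2.2)
      - dist t.1 t.2.2 • lp.evalCLM ℝ (fun _ : Y × Y => ℝ) ∞ (t.1, t.2.2)))

variable {Y : Type*} [MetricSpace Y]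

lemma mem_lipQuotients {f : lp (fun _ : Y × Y => ℝ) ∞} :
    f ∈ lipQuotients Y ↔ ∀ a b c, dist a b * f (a, b) + dist b c * f (b, c) = dist a c * f (a, c) := by
  simp [lipQuotients, Submodule.mem_iInf, sub_eq_zero]
  rfl

instance : CompleteSpace (lipQuotients Y) := by
  refine IsClosed.completeSpace_coe (hs := ?_)
  simp only [lipQuotients, Submodule.coe_iInf]
  exact isClosed_iInter fun t => ContinuousLinearMap.isClosed_ker _

/-- The function with the given difference quotients that vanishes at `y₀`. -/
noncomputable def lipPrimitive (y₀ : Y) : lipQuotients Y →ₗ[ℝ] (Y → ℝ) where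
  toFun f y := dist y y₀ * f.1 (y, y₀)
  map_add' f g := by ext y; simp [mul_add]
  map_smul' r f := by ext y; simp; ring

lemma lipPrimitive_sub (y₀ : Y) (f : lipQuotients Y) (a b : Y) :
    lipPrimitive y₀ f a - lipPrimitive y₀ f b = dist a b * f.1 (a, b) := by
  have h := mem_lipQuotients.1 f.2 a b y₀
  simp only [lipPrimitive, LinearMap.coe_mk, AddHom.coe_mk]
  linarith

lemma memLip_lipPrimitive (y₀ : Y) (f : lipQuotients Y) : MemLip (lipPrimitive y₀ f) := by
  refine ⟨‖f‖₊, LipschitzWith.of_dist_le_mul fun a b => ?_⟩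
  rw [Real.dist_eq, lipPrimitive_sub, abs_mul, abs_of_nonneg dist_nonneg, mul_comm]
  exact mul_le_mul_of_nonneg_right (lp.norm_apply_le_norm (by simp) f.1 (a, b)) dist_nonneg

/-- Fixing the value at `y₀` gives a majorant that depends on `f` only through its norm; composed
with `φ`, the remaining factor is one fixed locally summable function. -/
lemma abs_lipPrimitive_le (y₀ : Y) (f : lipQuotients Y) (y : Y) :
    |lipPrimitive y₀ f y| ≤ ‖f‖ * dist y y₀ := by
  simp only [lipPrimitive, LinearMap.coe_mk, AddHom.coe_mk]
  rw [abs_mul, abs_of_nonneg dist_nonneg, mul_comm]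
  exact mul_le_mul_of_nonneg_right (lp.norm_apply_le_norm (by simp) f.1 (y, y₀)) dist_nonneg

lemma MemLip.lipSeminorm_ne_top {u : Y → ℝ} (hu : MemLip u) : lipSeminorm u ≠ ⊤ := by
  obtain ⟨K, hK⟩ := hu
  refine ne_top_of_le_ne_top (b := (K : ℝ≥0∞)) (by simp) ?_
  refine iSup_le fun a => iSup_le fun b => iSup_le fun hab => ?_
  refine ENNReal.ofReal_le_of_le_toReal ?_
  rw [div_le_iff₀ (dist_pos.2 hab)]
  exact hK.dist_le_mul a b

lemma abs_sub_le_lipSeminorm_mul {u : Y → ℝ} (hu : MemLip u) (a b : Y) :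
    |u a - u b| ≤ (lipSeminorm u).toReal * dist a b := by
  rcases eq_or_ne a b with rfl | hab
  · simp
  rw [← div_le_iff₀ (dist_pos.2 hab), ← ENNReal.ofReal_le_iff_le_toReal hu.lipSeminorm_ne_top]
  exact le_iSup_of_le a (le_iSup_of_le b (le_iSup_of_le hab le_rfl))

lemma exists_lipPrimitive_eq (y₀ : Y) {u : Y → ℝ} (hu : MemLip u) :
    ∃ f : lipQuotients Y, ‖f‖ ≤ (lipSeminorm u).toReal ∧ ∀ y, u y = lipPrimitive y₀ f y + u y₀ := by
  have hbound (p : Y × Y) : ‖(u p.1 - u p.2) / dist p.1 p.2‖ ≤ (lipSeminorm u).toReal := by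
    rw [norm_div, Real.norm_eq_abs, Real.norm_of_nonneg dist_nonneg]
    exact div_le_of_le_mul₀ dist_nonneg ENNReal.toReal_nonneg (abs_sub_le_lipSeminorm_mul hu _ _)
  -- On the diagonal the quotient is `0 / 0 = 0`, so the bound and the defining relation persist
  -- there.
  let f : lp (fun _ : Y × Y => ℝ) ∞ := ⟨fun p => (u p.1 - u p.2) / dist p.1 p.2,
    memℓp_infty ⟨_, forall_mem_range.2 hbound⟩⟩
  have hf (a b : Y) : dist a b * f (a, b) = u a - u b := by
    rcases eq_or_ne a b with rfl | hab
    · simp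
    · exact mul_div_cancel₀ _ (dist_pos.2 hab).ne'
  refine ⟨⟨f, mem_lipQuotients.2 fun a b c => by simp only [hf]; ring⟩,
    lp.norm_le_of_forall_le ENNReal.toReal_nonneg hbound, fun y => ?_⟩
  simp only [lipPrimitive, LinearMap.coe_mk, AddHom.coe_mk, hf]
  ring

end LipschitzQuotients

/-! ### The closed graph argument. -/

section ClosedGraph

variable {E G Y : Type*} [NormedAddCommGroup E] [NormedSpace ℝ E] [FiniteDimensional ℝ E]
  [TopologicalSpace G] [T2Space G] [SecondCountableTopology G] [LocallyCompactSpace G]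
  [ChartedSpace E G] [Group G] [LieGroup 𝓘(ℝ, E) ∞ G]
  [MeasurableSpace G] [BorelSpace G] [MetricSpace Y]
  {μ : Measure G} {Ω : Set G} {n : ℕ} {V : Submodule ℝ (GroupLieAlgebra 𝓘(ℝ, E) G)}
  {X : Module.Basis (Fin n) ℝ V} {q : ℝ≥0∞} {φ : G → Y}

/-- The integral of a component of an `L_q` field against a test function is continuous. -/
lemma continuous_integral_coord_mul [IsFiniteMeasureOnCompacts μ] [Fact (1 ≤ q)] (j : Fin n)
    {v : G → ℝ} (hv : Continuous v) (hc : HasCompactSupport v) :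
    Continuous fun g : Lp (EuclideanSpace ℝ (Fin n)) q (μ.restrict Ω) =>
      ∫ x in Ω, g x j * v x ∂μ := by
  -- The test function lies in the dual exponent's space, so Hölder's inequality gives continuity
  -- for every `q` from `1` to `∞`.
  have hconj : q.HolderConjugate q.conjExponent :=
    ENNReal.HolderConjugate.conjExponent (Fact.out : 1 ≤ q)
  have : Fact (1 ≤ q.conjExponent) := ⟨ENNReal.HolderConjugate.one_le q.conjExponent q⟩
  have hvm : MemLp v q.conjExponent (μ.restrict Ω) := hv.memLp_of_hasCompactSupport hc
  let B : EuclideanSpace ℝ (Fin n) →L[ℝ] ℝ →L[ℝ] ℝ :=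
    (ContinuousLinearMap.mul ℝ ℝ).comp (EuclideanSpace.proj j)
  have h := ((ContinuousLinearMap.lpPairing (μ.restrict Ω) q q.conjExponent B).flip
    (hvm.toLp v)).continuous
  convert h using 2 with g
  rw [ContinuousLinearMap.flip_apply, ContinuousLinearMap.lpPairing_eq_integral]
  refine integral_congr_ae ?_
  filter_upwards [hvm.coeFn_toLp] with x hx
  rw [hx]
  rfl

/-- The integral of `u ∘ φ` against a derivative of a test function depends continuously on `u`. -/
lemma continuous_integral_lipPrimitive_mul (y₀ : Y)
    (hφ : ∀ u : Y → ℝ, MemLip u → MemHomSobolev q μ Ω X (u ∘ φ))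
    (ξ : GroupLieAlgebra 𝓘(ℝ, E) G) {v : G → ℝ}
    (hv : ContMDiff 𝓘(ℝ, E) 𝓘(ℝ, ℝ) ∞ v) (hc : HasCompactSupport v) (hs : tsupport v ⊆ Ω) :
    Continuous fun f : lipQuotients Y =>
      ∫ x in Ω, (lipPrimitive y₀ f ∘ φ) x * leftInvDeriv ξ v x ∂μ := by
  have hint {u : Y → ℝ} (hu : MemLip u) :
      IntegrableOn (fun x => (u ∘ φ) x * leftInvDeriv ξ v x) Ω μ :=
    (hφ u hu).1.integrableOn_mul_leftInvDeriv ξ hv hc hs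
  -- The hypothesis on `φ` applied to this particular Lipschitz function makes the majorant
  -- integrable.
  have hdist : MemLip fun y => dist y y₀ := ⟨1, LipschitzWith.dist_left y₀⟩
  let Λ : lipQuotients Y →ₗ[ℝ] ℝ :=
    { toFun := fun f => ∫ x in Ω, (lipPrimitive y₀ f ∘ φ) x * leftInvDeriv ξ v x ∂μ
      map_add' := fun f g => by
        rw [← integral_add (hint (memLip_lipPrimitive y₀ f)) (hint (memLip_lipPrimitive y₀ g))]
        simp [add_mul]
      map_smul' := fun r f => by
        rw [RingHom.id_apply, smul_eq_mul, ← integral_const_mul]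
        simp [mul_assoc] }
  refine (Λ.mkContinuous (∫ x in Ω, ‖dist (φ x) y₀ * leftInvDeriv ξ v x‖ ∂μ) fun f => ?_).continuous
  rw [mul_comm, ← integral_const_mul]
  refine norm_integral_le_of_norm_le ((hint hdist).norm.const_mul _)
    (Filter.Eventually.of_forall fun x => ?_)
  rw [norm_mul, norm_mul, ← mul_assoc, Real.norm_of_nonneg dist_nonneg]
  exact mul_le_mul_of_nonneg_right (abs_lipPrimitive_le y₀ f (φ x)) (norm_nonneg _)

variable (μ Ω X q) in
/-- The composition operator followed by the horizontal gradient. -/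
noncomputable def gradientComp (hΩ : IsOpen Ω) (y₀ : Y)
    (hφ : ∀ u : Y → ℝ, MemLip u → MemHomSobolev q μ Ω X (u ∘ φ)) :
    lipQuotients Y →ₗ[ℝ] Lp (EuclideanSpace ℝ (Fin n)) q (μ.restrict Ω) where
  toFun f := ((hφ _ (memLip_lipPrimitive y₀ f)).memLp hΩ).toLp
  map_add' f g := by
    rw [← MemLp.toLp_add, MemLp.toLp_eq_toLp_iff]
    exact horizontalGradient_add hΩ (hφ _ (memLip_lipPrimitive y₀ f))
      (hφ _ (memLip_lipPrimitive y₀ g)) (hφ _ (memLip_lipPrimitive y₀ (f + g))) fun x => by simp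
  map_smul' r f := by
    rw [RingHom.id_apply, ← MemLp.toLp_const_smul, MemLp.toLp_eq_toLp_iff]
    exact horizontalGradient_const_mul hΩ (hφ _ (memLip_lipPrimitive y₀ f))
      (hφ _ (memLip_lipPrimitive y₀ (r • f))) r fun x => by simp

/-- Both sides of the integration by parts identity are continuous, one in the `L_q` gradient and
the other in the difference quotients. Hence an `L_q` limit of gradients is a gradient of the limit
function, and uniqueness closes the graph. -/
lemma continuous_gradientComp [μ.IsHaarMeasure] [Fact (1 ≤ q)] (hΩ : IsOpen Ω) (y₀ : Y)
    (hφ : ∀ u : Y → ℝ, MemLip u → MemHomSobolev q μ Ω X (u ∘ φ)) :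
    Continuous (gradientComp μ Ω X q hΩ y₀ hφ) := by
  refine LinearMap.continuous_of_seq_closed_graph _ fun u f g hu hg => ?_
  have hmem (f) := hφ _ (memLip_lipPrimitive y₀ f)
  have hcoe (f) : gradientComp μ Ω X q hΩ y₀ hφ f =ᵐ[μ.restrict Ω]
      horizontalGradient μ Ω X (lipPrimitive y₀ f ∘ φ) := ((hmem f).memLp hΩ).coeFn_toLp
  have hgrad : IsHorizontalGradient μ Ω X (lipPrimitive y₀ f ∘ φ) g := by
    intro j
    have hgj : MemLp (fun x => g x j) q (μ.restrict Ω) :=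
      (EuclideanSpace.proj (𝕜 := ℝ) j).comp_memLp' (Lp.memLp g)
    refine ⟨locallyIntegrableOn_of_locallyIntegrable_restrict
      (hgj.locallyIntegrable Fact.out), fun v hv hc hs => ?_⟩
    have h1 := ((continuous_integral_coord_mul (μ := μ) (Ω := Ω) j hv.continuous hc).tendsto g).comp hg
    have h2 := ((continuous_integral_lipPrimitive_mul y₀ hφ (X j).1 hv hc hs).tendsto f).comp hu
    refine tendsto_nhds_unique (h1.congr fun k => ?_) h2.neg
    refine Eq.trans ?_ (((hmem (u k)).isHorizontalGradient j).2 v hv hc hs)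
    refine integral_congr_ae ?_
    filter_upwards [hcoe (u k)] with x hx
    simp only [comp_apply, hx]
  refine Lp.ext ?_
  exact (hgrad.ae_eq hΩ (hmem f).isHorizontalGradient).trans (hcoe f).symm

end ClosedGraph

theorem proposition4p7 {E G Y : Type*}
    [NormedAddCommGroup E] [NormedSpace ℝ E] [FiniteDimensional ℝ E]
    [TopologicalSpace G] [T2Space G] [SecondCountableTopology G] [SimplyConnectedSpace G]
    [ChartedSpace E G] [Group G] [LieGroup 𝓘(ℝ, E) ∞ G]
    [MeasurableSpace G] [BorelSpace G]
    (S : Stratification E G) {n : ℕ} (X : Module.Basis (Fin n) ℝ S.horizontal)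
    (μ : Measure G) [μ.IsHaarMeasure]
    [MetricSpace Y] (Ω : Set G) (hΩ_open : IsOpen Ω) (hΩ_conn : IsConnected Ω)
    (q : ℝ≥0∞) (hq : 1 ≤ q) (φ : G → Y)
    (hφ : ∀ u : Y → ℝ, MemLip u → MemHomSobolev q μ Ω X (u ∘ φ)) :
    InducesBoundedCompositionOperator q μ Ω X φ := by
  have : LocallyCompactSpace G := Manifold.locallyCompact_of_finiteDimensional 𝓘(ℝ, E)
  have : Fact (1 ≤ q) := ⟨hq⟩
  refine ⟨hφ, ?_⟩
  -- The base point `φ 1` is merely some point of `Y`; the neutral element need not lie in `Ω`.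
  let T : lipQuotients Y →L[ℝ] Lp (EuclideanSpace ℝ (Fin n)) q (μ.restrict Ω) :=
    ⟨gradientComp μ Ω X q hΩ_open (φ 1) hφ, continuous_gradientComp hΩ_open (φ 1) hφ⟩
  refine ⟨‖T‖₊, fun u hu => ?_⟩
  obtain ⟨f, hf, huf⟩ := exists_lipPrimitive_eq (φ 1) hu
  have hmem := hφ _ (memLip_lipPrimitive (φ 1) f)
  -- `u ∘ φ` differs from the normalized primitive composed with `φ` by the constant `u (φ 1)`,
  -- which the gradient does not see.
  have hae := horizontalGradient_add_const S hΩ_open hmem (hφ u hu) (u (φ 1)) fun x => huf (φ x)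
  calc homSobolevSeminorm q μ Ω X (u ∘ φ)
      = ‖T f‖ₑ := by
        rw [homSobolevSeminorm, eLpNorm_congr_ae hae]
        exact (Lp.enorm_toLp (hmem.memLp hΩ_open)).symm
    _ ≤ ‖T‖ₑ * ‖f‖ₑ := T.le_opENorm f
    _ ≤ ‖T‖₊ * lipSeminorm u := by
        gcongr
        · rfl
        rw [← ofReal_norm]
        exact ENNReal.ofReal_le_of_le_toReal hf
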